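/- Let $\mathcal V$ be a congruence distributive variety, that is, a class of algebras of a common finitary type which is closed under homomorphic images, subalgebras and direct products, and in which every member has a distributive lattice of congruences. Let $A\in\mathcal V$ be a finite algebra, and let $C$ be the clone of term operations of $A$. Operations $f\colon A^k\to A$ and $g\colon A^m\to A$ are said to commute if $$g\bigl(f(a_{11},\dots,a_{1k}),\dots,f(a_{m1},\dots,a_{mk})\bigr)=f\bigl(g(a_{11},\dots,a_{m1}),\dots,g(a_{1k},\dots,a_{mk})\bigr)$$ for all $a_{ij}\in A$ ($1\le i\le m$, $1\le j\le k$). Let $C^\ast$ denote the set of all finitary operations on $A$ that commute with every member of $C$. An operation $f\colon A^n\to A$ is called essentially $n$-ary if it depends on each of its $n$ variables, i.e., for every $i$ there are tuples in $A^n$ differing only in their $i$-th component on which $f$ takes different values. If, for some integer $n\ge 0$, there is an essentially $n$-ary operation in $C^\ast$, then $n\le\log_2|A|$. -/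

import Mathlib

open scoped FirstOrder

universe u v w

namespace UnivAlg

/-! ### Operations on a set -/

/-- Finitary operations on `A`, each one together with its arity `n ≥ 0`. -/
abbrev Operation (A : Type w) : Type w := Σ n : ℕ, (Fin n → A) → A

/-- The `i`-th variable of `f` is essential. -/
def DependsOnVar {A : Type w} {n : ℕ} (f : (Fin n → A) → A) (i : Fin n) : Prop :=
  ∃ a a' : Fin n → A, (∀ j, j ≠ i → a j = a' j) ∧ f a ≠ f a'

/-- `f` is an essentially `n`-ary operation: it is `n`-ary and depends on all of its variables. -/
def IsEssentiallyNary {A : Type w} {n : ℕ} (f : (Fin n → A) → A) : Prop :=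
  ∀ i : Fin n, DependsOnVar f i

/-- The operations `f` and `g` commute. -/
def Commute {A : Type w} (f g : Operation A) : Prop :=
  ∀ a : Fin g.1 → Fin f.1 → A,
    g.2 (fun i => f.2 (fun j => a i j)) = f.2 (fun j => g.2 (fun i => a i j))

/-- The centralizer of a set of operations. -/
def centralizer {A : Type w} (F : Set (Operation A)) : Set (Operation A) :=
  {g | ∀ f ∈ F, Commute f g}

/-! ### Algebras

An algebra of a given similarity type is a structure for a first-order language `L` without
relation symbols. -/

/-- The clone of term operations of the algebra `A`. -/
def termClone (L : FirstOrder.Language.{u, v}) (A : Type w) [L.Structure A] : Set (Operation A) :=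
  {f | ∃ t : L.Term (Fin f.1), ∀ x : Fin f.1 → A, f.2 x = t.realize x}

/-- The direct product of a family of algebras, with componentwise operations. -/
@[reducible]
def piStructure (L : FirstOrder.Language.{u, v}) {I : Type*} (B : I → Type*) [∀ i, L.Structure (B i)] :
    L.Structure (∀ i, B i) where
  funMap f x := fun i => FirstOrder.Language.Structure.funMap f (fun k => x k i)
  RelMap r x := ∀ i, FirstOrder.Language.Structure.RelMap r (fun k => x k i)

/-- A variety: a class of algebras closed under homomorphic images, subalgebras and arbitrary
direct products. If the type has no constants, an algebra may have an empty subalgebra; it is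
left open whether the empty algebra belongs to the class. -/
structure IsVariety (L : FirstOrder.Language.{u, v}) (V : Set (CategoryTheory.Bundled.{w} L.Structure)) : Prop where
  image : ∀ (M N : Type w) [L.Structure M] [L.Structure N] (φ : M →[L] N),
    Function.Surjective φ → CategoryTheory.Bundled.of (c := L.Structure) M ∈ V →
      CategoryTheory.Bundled.of (c := L.Structure) N ∈ V
  subalgebra : ∀ (M : Type w) [L.Structure M] (S : L.Substructure M), (S : Set M).Nonempty →
    CategoryTheory.Bundled.of (c := L.Structure) M ∈ V → CategoryTheory.Bundled.of (c := L.Structure) S ∈ V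
  product : ∀ (I : Type w) (B : I → Type w) [∀ i, L.Structure (B i)],
    (∀ i, CategoryTheory.Bundled.of (c := L.Structure) (B i) ∈ V) →
      (⟨∀ i, B i, piStructure L B⟩ : CategoryTheory.Bundled.{w} L.Structure) ∈ V

/-! ### Congruences -/

/-- A congruence of the algebra `A`: an equivalence relation compatible with all operations. -/
@[ext]
structure Congruence (L : FirstOrder.Language.{u, v}) (A : Type w) [L.Structure A] where
  toSetoid : Setoid A
  compat : ∀ {n : ℕ} (f : L.Functions n) (x y : Fin n → A), (∀ i, toSetoid (x i) (y i)) →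
    toSetoid (FirstOrder.Language.Structure.funMap f x) (FirstOrder.Language.Structure.funMap f y)

namespace Congruence

variable {L : FirstOrder.Language.{u, v}} {A : Type w} [L.Structure A]

/-- Congruences are ordered by inclusion. -/
instance : PartialOrder (Congruence L A) :=
  PartialOrder.lift Congruence.toSetoid (fun _ _ h => Congruence.ext h)

instance : InfSet (Congruence L A) where
  sInf S :=
    { toSetoid := sInf (Congruence.toSetoid '' S)
      compat := by
        intro n f x y h
        rintro _ ⟨θ, hθ, rfl⟩
        exact θ.compat f x y (fun i => h i _ ⟨θ, hθ, rfl⟩) }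

theorem isGLB_sInf (S : Set (Congruence L A)) : IsGLB S (sInf S) :=
  ⟨fun θ hθ _ _ h => h _ ⟨θ, hθ, rfl⟩, fun ψ hψ x y h => by
    rintro _ ⟨θ, hθ, rfl⟩
    exact hψ hθ h⟩

/-- `Con A`, the lattice of congruences of `A` with respect to inclusion; the meet of two
congruences is their intersection, their join is the least congruence containing both. -/
instance : CompleteLattice (Congruence L A) where
  __ := completeLatticeOfInf (Congruence L A) isGLB_sInf
  inf θ ψ :=
    { toSetoid := θ.toSetoid ⊓ ψ.toSetoid
      compat := fun f x y h =>
        ⟨θ.compat f x y (fun i => (h i).1), ψ.compat f x y (fun i => (h i).2)⟩ }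
  inf_le_left _ _ _ _ h := h.1
  inf_le_right _ _ _ _ h := h.2
  le_inf _ _ _ h₁ h₂ _ _ h := ⟨h₁ h, h₂ h⟩

end Congruence

/-- The class `V` is congruence distributive: `Con B` is a distributive lattice for each member
`B` of `V`. -/
def IsCongruenceDistributive {L : FirstOrder.Language.{u, v}} (V : Set (CategoryTheory.Bundled.{w} L.Structure)) : Prop :=
  ∀ (B : Type w) [L.Structure B], CategoryTheory.Bundled.of (c := L.Structure) B ∈ V →
    ∀ θ φ ψ : Congruence L B, θ ⊓ (φ ⊔ ψ) = (θ ⊓ φ) ⊔ (θ ⊓ ψ)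

end UnivAlg

/-!
An operation `f` commuting with all term operations of `A` is a homomorphism `A ^ n → A`. Its
kernel `θ` is a congruence of `A ^ n`, a member of the variety, whose congruence lattice is
distributive; let `π i` be the kernel of the `i`-th projection. Since `⨅ i, π i` is trivial,
distributivity gives `θ = θ ⊔ ⨅ i, π i = ⨅ i, θ ⊔ π i`, so every congruence of `A ^ n` is a product
congruence (`UnivAlg.Congruence.rel_of_forall_sup`).

Since `f` depends on its `i`-th variable, there are tuples `a i`, `a' i` differing only at `i`
with distinct values under `f`. They are related by `θ ⊔ π j` for all `j ≠ i`, hence not by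
`θ ⊔ π i`: the `i`-th factor of `θ` separates their `i`-th entries. Therefore the `2 ^ n`
tuples obtained by choosing at each `i` the entry of `a i` or that of `a' i` have pairwise
distinct images, and `2 ^ n ≤ |A|`.
-/

namespace UnivAlg

open FirstOrder.Language

namespace Congruence

variable {L : FirstOrder.Language.{u, v}}

/-- The kernel of a map that preserves the basic operations. -/
def ker {A B : Type*} [L.Structure A] [L.Structure B] (φ : A → B)
    (hφ : ∀ {m : ℕ} (g : L.Functions m) (x : Fin m → A),
      φ (Structure.funMap g x) = Structure.funMap g (φ ∘ x)) : Congruence L A where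
  toSetoid := Setoid.ker φ
  compat g x y h := by
    have hxy : φ ∘ x = φ ∘ y := funext h
    change φ _ = φ _
    rw [hφ, hφ, hxy]

theorem rel_iff_of_finset_inf {A ι : Type*} [L.Structure A] (s : Finset ι)
    (π : ι → Congruence L A) (x y : A) :
    (s.inf π).toSetoid x y ↔ ∀ i ∈ s, (π i).toSetoid x y := by
  classical
  induction s using Finset.induction_on with
  | empty =>
    have htop : (⊤ : Congruence L A).toSetoid x y := by
      rintro _ ⟨_, h, rfl⟩
      exact h.elim
    exact iff_of_true htop fun _ hi => absurd hi (Finset.notMem_empty _)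
  | insert i s _ ih =>
    rw [Finset.inf_insert, Finset.forall_mem_insert, ← ih]
    exact Iff.rfl

/-- If finitely many congruences `π i` of a congruence distributive algebra meet in the equality
relation, then every congruence `θ` is the meet of the congruences `θ ⊔ π i`. -/
theorem rel_of_forall_sup {A ι : Type*} [L.Structure A] [Fintype ι]
    (hdist : ∀ θ φ ψ : Congruence L A, θ ⊓ (φ ⊔ ψ) = (θ ⊓ φ) ⊔ (θ ⊓ ψ))
    (π : ι → Congruence L A) (hπ : ∀ x y, (∀ i, (π i).toSetoid x y) → x = y)
    (θ : Congruence L A) {x y : A} (h : ∀ i, (θ ⊔ π i).toSetoid x y) : θ.toSetoid x y := by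
  let : DistribLattice (Congruence L A) :=
    DistribLattice.ofInfSupLe fun θ φ ψ => (hdist θ φ ψ).le
  have hinf : Finset.univ.inf π ≤ θ := fun {x y} hxy => by
    obtain rfl := hπ x y fun i => (rel_iff_of_finset_inf _ π x y).1 hxy i (Finset.mem_univ i)
    exact θ.toSetoid.refl x
  have hsup : Finset.univ.inf (fun i => θ ⊔ π i) = θ :=
    (Finset.inf_sup_distrib_left Finset.univ π θ).symm.trans (sup_eq_left.2 hinf)
  rw [← hsup]
  exact (rel_iff_of_finset_inf _ _ x y).2 fun i _ => h i

end Congruence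

/-- An operation commuting with all term operations commutes with the basic operations. -/
theorem map_funMap_of_mem_centralizer {L : FirstOrder.Language.{u, v}} {A : Type w}
    [L.Structure A] {n : ℕ} {f : (Fin n → A) → A}
    (hf : (⟨n, f⟩ : Operation A) ∈ centralizer (termClone L A)) {m : ℕ} (g : L.Functions m)
    (x : Fin m → Fin n → A) :
    f (fun i => Structure.funMap g fun k => x k i) = Structure.funMap g fun k => f (x k) :=
  hf ⟨m, Structure.funMap g⟩ ⟨func g Term.var, fun _ => rfl⟩ fun i k => x k i

/-- If `A ^ n` has a distributive congruence lattice, then an essentially `n`-ary operation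
commuting with all term operations of `A` takes at least `2 ^ n` values; hence `2 ^ n ≤ |A|`.
The exponent is encoded as `ULift (Fin n)`, an index type in the universe of `A`. -/
theorem two_pow_le_card_of_isEssentiallyNary {L : FirstOrder.Language.{u, v}} (A : Type w)
    [L.Structure A] [Finite A] {n : ℕ}
    (hdist : letI := piStructure L (fun _ : ULift.{w} (Fin n) => A)
      ∀ θ φ ψ : Congruence L (ULift.{w} (Fin n) → A), θ ⊓ (φ ⊔ ψ) = (θ ⊓ φ) ⊔ (θ ⊓ ψ))
    {f : (Fin n → A) → A} (hf : IsEssentiallyNary f)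
    (hfC : (⟨n, f⟩ : Operation A) ∈ centralizer (termClone L A)) : 2 ^ n ≤ Nat.card A := by
  classical
  let := piStructure L (fun _ : ULift.{w} (Fin n) => A)
  let θ : Congruence L (ULift.{w} (Fin n) → A) :=
    Congruence.ker (fun x => f fun i => x ⟨i⟩) fun g x =>
      map_funMap_of_mem_centralizer hfC g fun k i => x k ⟨i⟩
  let π (i : Fin n) : Congruence L (ULift.{w} (Fin n) → A) :=
    Congruence.ker (fun x => x ⟨i⟩) fun _ _ => rfl
  choose a a' heq hne using hf
  have hsep (i : Fin n) :
      ¬ (θ ⊔ π i).toSetoid (fun j => a i j.down) (fun j => a' i j.down) := fun h => by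
    have hmeet (x y : ULift.{w} (Fin n) → A) (hxy : ∀ j, (π j).toSetoid x y) : x = y :=
      funext fun j => hxy j.down
    refine hne i (show θ.toSetoid (fun j => a i j.down) (fun j => a' i j.down) from
      Congruence.rel_of_forall_sup hdist π hmeet θ fun j => ?_)
    by_cases hj : j = i
    · exact hj ▸ h
    · exact (le_sup_right : π j ≤ θ ⊔ π j) (heq i j hj)
  let c (S : Fin n → Bool) (i : Fin n) : A := if S i then a i i else a' i i
  -- If `S` and `T` differ at `i`, a chain `a i`, `c S`, `c T`, `a' i` (with links `π i`, `θ`, `π i`)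
  -- would contradict `hsep i`.
  have hval {S T : Fin n → Bool} (h : f (c S) = f (c T)) (i : Fin n) (hS : S i = true) :
      T i = true := by
    by_contra hT
    have h₁ : (π i).toSetoid (fun j => a i j.down) (fun j => c S j.down) :=
      (if_pos hS).symm
    have h₂ : (π i).toSetoid (fun j => c T j.down) (fun j => a' i j.down) :=
      if_neg hT
    have hπ : π i ≤ θ ⊔ π i := le_sup_right
    have hθ : θ ≤ θ ⊔ π i := le_sup_left
    have h₃ : θ.toSetoid (fun j => c S j.down) (fun j => c T j.down) := h
    exact hsep i ((θ ⊔ π i).toSetoid.trans (hπ h₁)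
      ((θ ⊔ π i).toSetoid.trans (hθ h₃) (hπ h₂)))
  have hinj : Function.Injective fun S => f (c S) := fun S T h =>
    funext fun i => Bool.eq_iff_iff.2 ⟨hval h i, hval h.symm i⟩
  simpa using Nat.card_le_card_of_injective _ hinj

end UnivAlg

theorem mainTheorem10 (L : FirstOrder.Language.{u, v}) [L.IsAlgebraic]
    (V : Set (CategoryTheory.Bundled.{w} L.Structure)) (hV : UnivAlg.IsVariety L V)
    (hCD : UnivAlg.IsCongruenceDistributive V)
    (A : Type w) [L.Structure A] [Finite A] (hA : CategoryTheory.Bundled.of (c := L.Structure) A ∈ V)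
    (n : ℕ) (f : (Fin n → A) → A) (hf : UnivAlg.IsEssentiallyNary f)
    (hfC : (⟨n, f⟩ : UnivAlg.Operation A) ∈ UnivAlg.centralizer (UnivAlg.termClone L A)) :
    (n : ℝ) ≤ Real.logb 2 (Nat.card A) := by
  have hpow : 2 ^ n ≤ Nat.card A :=
    UnivAlg.two_pow_le_card_of_isEssentiallyNary A
      (@hCD (ULift.{w} (Fin n) → A) (UnivAlg.piStructure L fun _ => A)
        (hV.product (ULift.{w} (Fin n)) (fun _ => A) fun _ => hA)) hf hfC
  have hpos : (0 : ℝ) < Nat.card A := by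
    exact_mod_cast (Nat.two_pow_pos n).trans_le hpow
  rw [Real.le_logb_iff_rpow_le one_lt_two hpos, Real.rpow_natCast]
  exact_mod_cast hpow
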